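/- Let $\mathbb N^\times$ be the multiplicative monoid of positive integers, regarded as a category with one object $*$, and let $\widehat{\mathbb N^\times}$ be the topos of presheaves of sets on it. A point $p$ of $\widehat{\mathbb N^\times}$ is a geometric morphism $\mathrm{Set}\to\widehat{\mathbb N^\times}$, i.e. a left exact functor $p^*:\widehat{\mathbb N^\times}\to\mathrm{Set}$ together with a right adjoint $p_*$; a morphism of points $p\to q$ is a natural transformation $p^*\to q^*$. Let $L_{Pt}$ be the one-sorted language with a unary function symbol $F_n$ for each positive integer $n$ and no other symbols. A functor $A:\mathbb N^\times\to\mathrm{Set}$ is regarded as the $L_{Pt}$-structure with underlying set $A(*)$ in which $F_n$ is $A(n)$, and a point $p$ is regarded as the $L_{Pt}$-structure of the functor $p^*\circ y$, where $y:\mathbb N^\times\to\widehat{\mathbb N^\times}$ is the Yoneda embedding. A functor $A:\mathbb N^\times\to\mathrm{Set}$ with $X=A(*)$, $A(n)(x)=nx$, is flat if (i) $X\neq\emptyset$; (ii) for all $y,z\in X$ there are $m,n\ge 1$ and $w\in X$ with $mw=y$ and $nw=z$; (iii) whenever $my=ny$ with $y\in X$, there are $p\ge 1$ and $z\in X$ with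 $mp=np$ and $pz=y$. Theorem. The class of points of $\widehat{\mathbb N^\times}$ is geometric over the language $L_{Pt}$. Precisely, let $T$ be the geometric theory over $L_{Pt}$ (a set of sequents between formulas built from atomic ones by finite conjunctions, set-indexed disjunctions and existential quantifiers) with the axioms, for all $m,n\ge 1$, $$\top\vdash_x F_1(x)=x,\qquad \top\vdash_x F_m(F_n(x))=F_{mn}(x),\qquad \top\vdash \exists x\,\top,$$ $$\top\vdash_{y,z}\bigvee_{k,l\ge1}\exists w\,\bigl(F_k(w)=y\wedge F_l(w)=z\bigr),\qquad F_m(y)=F_n(y)\vdash_{y}\bigvee_{p\ge 1,\ mp=np}\exists z\;F_p(z)=y .$$ Then: 1. an $L_{Pt}$-structure is a model of $T$ if and only if it is isomorphic to the structure of a flat functor $\mathbb N^\times\to\mathrm{Set}$; 2. an $L_{Pt}$-structure is a model of $T$ if and only if it is isomorphic to the structure of a point of $\widehat{\mathbb N^\times}$; 3. the functor sending a point to its $L_{Pt}$-structure is an equivalence from the category of points of $\widehat{\mathbb N^\times}$ to the category of models of $T$ in $\mathrm{Set}$ and all their homomorphisms. -/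

import Mathlib

open CategoryTheory FirstOrder

/-! ### Geometric logic -/

namespace FirstOrder.Language

/-- Geometric formulas of a one-sorted language in the context of `n` free variables: they are built
from atomic formulas by finite conjunctions (`⊤` and binary `∧`), set-indexed disjunctions and
existential quantification. In `ex φ` the bound variable is the last one of `φ`. -/
inductive GeometricFormula (L : Language.{0, 0}) : ℕ → Type 1
  | equal {n : ℕ} (s t : L.Term (Fin n)) : GeometricFormula L n
  | rel {n k : ℕ} (R : L.Relations k) (ts : Fin k → L.Term (Fin n)) : GeometricFormula L n
  | top {n : ℕ} : GeometricFormula L n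
  | and {n : ℕ} (φ ψ : GeometricFormula L n) : GeometricFormula L n
  | or {n : ℕ} {ι : Type} (φ : ι → GeometricFormula L n) : GeometricFormula L n
  | ex {n : ℕ} (φ : GeometricFormula L (n + 1)) : GeometricFormula L n

/-- Satisfaction of a geometric formula in a structure, under an assignment of its variables. -/
def GeometricFormula.Realize {L : Language.{0, 0}} {M : Type} [L.Structure M] :
    {n : ℕ} → L.GeometricFormula n → (Fin n → M) → Prop
  | _, .equal s t, v => s.realize v = t.realize v
  | _, .rel R ts, v => Structure.RelMap R (fun i => (ts i).realize v)
  | _, .top, _ => True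
  | _, .and φ ψ, v => φ.Realize v ∧ ψ.Realize v
  | _, .or φ, v => ∃ i, (φ i).Realize v
  | n, .ex φ, v => ∃ x : M, φ.Realize (Fin.snoc v x : Fin (n + 1) → M)

/-- A geometric sequent `hyp ⊢ concl` in the context of `n` variables. -/
structure GeometricSequent (L : Language.{0, 0}) where
  /-- the number of variables of the context -/
  n : ℕ
  /-- the formula on the left -/
  hyp : L.GeometricFormula n
  /-- the formula on the right -/
  concl : L.GeometricFormula n

/-- A sequent holds in `M` if every assignment that satisfies `hyp` satisfies `concl`. -/
def GeometricSequent.Holds {L : Language.{0, 0}} (σ : L.GeometricSequent) (M : Type)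
    [L.Structure M] : Prop :=
  ∀ v : Fin σ.n → M, σ.hyp.Realize v → σ.concl.Realize v

/-- A geometric theory is a (small) family of geometric sequents, its axioms. -/
structure GeometricTheory (L : Language.{0, 0}) where
  /-- the set that labels the axioms -/
  Index : Type
  /-- the axioms -/
  axioms_ : Index → L.GeometricSequent

/-- The category of `L`-structures (possibly empty) and their homomorphisms. -/
instance structureCategory (L : Language.{0, 0}) : Category (Bundled.{0} L.Structure) where
  Hom M N := M →[L] N
  id M := Hom.id L M
  comp f g := g.comp f

/-- The models in `Set` of a geometric theory, as a property of `L`-structures. Full subcategories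
being formed with all homomorphisms, `T.Models.FullSubcategory` is the category of models. -/
def GeometricTheory.Models {L : Language.{0, 0}} (T : L.GeometricTheory) :
    ObjectProperty (Bundled.{0} L.Structure) :=
  fun M => ∀ i, (T.axioms_ i).Holds M

end FirstOrder.Language

/-! ### Points of the topos -/

/-- A geometric morphism `E ⟶ F`: a left exact functor `F ⥤ E` (the inverse image) with a right
adjoint `E ⥤ F` (the direct image). -/
structure GeometricMorphism (E : Type*) [Category E] (F : Type*) [Category F] where
  /-- the inverse image functor -/
  inverseImage : F ⥤ E
  /-- the direct image functor -/
  directImage : E ⥤ F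
  /-- the adjunction -/
  adj : inverseImage ⊣ directImage
  /-- the inverse image functor is left exact -/
  leftExact : Limits.PreservesFiniteLimits inverseImage

/-- Morphisms of geometric morphisms are the natural transformations of inverse images. -/
instance GeometricMorphism.category (E : Type*) [Category E] (F : Type*) [Category F] :
    Category (GeometricMorphism E F) where
  Hom p q := p.inverseImage ⟶ q.inverseImage
  id p := 𝟙 p.inverseImage
  comp f g := NatTrans.vcomp f g

/-- The multiplicative monoid of positive integers, as a category with one object. -/
abbrev NTimes : Type := SingleObj ℕ+

/-- The topos of presheaves of sets on the multiplicative monoid of positive integers. -/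
abbrev NTimesHat : Type 1 := NTimesᵒᵖ ⥤ Type

/-- The category of points of the topos. -/
abbrev NTimesPt : Type 1 := GeometricMorphism Type NTimesHat

/-! ### Actions as structures -/

/-- The map `A(n)` on the set `A(*)` of a functor `A` from the monoid to sets. -/
abbrev CategoryTheory.Functor.act (A : NTimes ⥤ Type) (n : ℕ+)
    (y : A.obj (SingleObj.star ℕ+)) : A.obj (SingleObj.star ℕ+) :=
  A.map (X := SingleObj.star ℕ+) (Y := SingleObj.star ℕ+) n y

/-- The function symbols of the language of actions: a unary symbol for every positive integer. -/
inductive PtFunctions : ℕ → Type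
  | F (n : ℕ+) : PtFunctions 1

/-- The language with one sort, unary function symbols `F n` for the positive integers `n`, and no
relation symbols. -/
abbrev LPt : FirstOrder.Language.{0, 0} where
  Functions := PtFunctions
  Relations := fun _ => Empty

/-- The `LPt`-structure of an action, i.e. of a functor `A` from the monoid to sets: on the set
`A(*)`, the symbol `F n` is interpreted as `A(n)`. -/
instance CategoryTheory.Functor.ptStructure (A : NTimes ⥤ Type) :
    LPt.Structure (A.obj (SingleObj.star ℕ+)) where
  funMap
    | PtFunctions.F n, x => A.act n (x 0)
  RelMap r := r.elim

/-- The functor that sends an action to its `LPt`-structure, and an equivariant map to itself. -/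
def actionStructure : (NTimes ⥤ Type) ⥤ Bundled.{0} LPt.Structure where
  obj A := ⟨A.obj (SingleObj.star ℕ+), A.ptStructure⟩
  map {A B} η := show A.obj (SingleObj.star ℕ+) →[LPt] B.obj (SingleObj.star ℕ+) from
    { toFun := fun x => η.app (SingleObj.star ℕ+) x
      map_fun' := by
        rintro _ ⟨n⟩ x
        exact NatTrans.naturality_apply η (X := SingleObj.star ℕ+) (Y := SingleObj.star ℕ+) n (x 0)
      map_rel' := fun r => r.elim }

/-- The action of a point `p`: the composite of the Yoneda embedding with the inverse image functor.
Its set is `p^*(y(*))`, on which `n` acts by `p^*(y(n))`. -/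
def pointAction : NTimesPt ⥤ (NTimes ⥤ Type) where
  obj p := yoneda ⋙ p.inverseImage
  map f := Functor.whiskerLeft yoneda f

/-- The `LPt`-structure of a point. -/
def pointStructure : NTimesPt ⥤ Bundled.{0} LPt.Structure :=
  pointAction ⋙ actionStructure

/-- Flat actions of the multiplicative monoid of positive integers. -/
structure IsFlatAction (A : NTimes ⥤ Type) : Prop where
  nonempty : Nonempty (A.obj (SingleObj.star ℕ+))
  directed : ∀ y z : A.obj (SingleObj.star ℕ+), ∃ (m n : ℕ+) (w : A.obj (SingleObj.star ℕ+)),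
    A.act m w = y ∧ A.act n w = z
  equalizing : ∀ (m n : ℕ+) (y : A.obj (SingleObj.star ℕ+)),
    A.act m y = A.act n y →
    ∃ (p : ℕ+) (z : A.obj (SingleObj.star ℕ+)), m * p = n * p ∧
      A.act p z = y

/-! ### The theory of flat actions -/

/-- The term `F n t`. -/
abbrev LPt.ap {k : ℕ} (n : ℕ+) (t : LPt.Term (Fin k)) : LPt.Term (Fin k) :=
  FirstOrder.Language.Term.func (L := LPt) (l := 1) (PtFunctions.F n) (fun _ => t)

/-- The variable number `i`. -/
abbrev LPt.x {k : ℕ} (i : Fin k) : LPt.Term (Fin k) := FirstOrder.Language.Term.var i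

/-- Labels of the axioms of the theory of flat actions. -/
inductive FlatAxiom : Type
  | one
  | mul (m n : ℕ+)
  | nonempty
  | directed
  | equalizing (m n : ℕ+)

open FirstOrder.Language.GeometricFormula in
/-- The geometric theory of flat actions:
* `⊤ ⊢ F 1 x = x`;
* `⊤ ⊢ F m (F n x) = F (m * n) x`, for all `m`, `n`;
* `⊤ ⊢ ∃ x, ⊤`, in the empty context;
* `⊤ ⊢ ⋁ m n, ∃ w, F m w = y ∧ F n w = z`;
* `F m y = F n y ⊢ ⋁ p with m * p = n * p, ∃ z, F p z = y`, for all `m`, `n`. -/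
def flatTheory : LPt.GeometricTheory where
  Index := FlatAxiom
  axioms_
    | .one => ⟨1, top, equal (LPt.ap 1 (LPt.x 0)) (LPt.x 0)⟩
    | .mul m n => ⟨1, top, equal (LPt.ap m (LPt.ap n (LPt.x 0))) (LPt.ap (m * n) (LPt.x 0))⟩
    | .nonempty => ⟨0, top, ex top⟩
    | .directed => ⟨2, top, or fun mn : ℕ+ × ℕ+ =>
        ex (and (equal (LPt.ap mn.1 (LPt.x 2)) (LPt.x 0)) (equal (LPt.ap mn.2 (LPt.x 2)) (LPt.x 1)))⟩
    | .equalizing m n => ⟨1, equal (LPt.ap m (LPt.x 0)) (LPt.ap n (LPt.x 0)),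
        or fun p : {p : ℕ+ // m * p = n * p} => ex (equal (LPt.ap p.1 (LPt.x 1)) (LPt.x 0))⟩

/-!
A sequent between geometric formulas passes to retracts, because homomorphisms preserve geometric
formulas; in particular the models of a geometric theory are closed under isomorphism. An
`LPt`-structure satisfying the first two axioms is literally the structure of an action, and the
remaining three axioms then say that this action is flat, that is, that its category of elements is
cofiltered.

Points and flat actions correspond by Diaconescu's theorem for presheaf toposes, valid over any
small category `C`. An inverse image `F` preserves colimits, so it is the left Kan extension of its
restriction `yoneda ⋙ F`, and natural transformations out of `F` are determined by their restriction
to representables. If `F` is also left exact then its category of elements is cofiltered; every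
element of `F` comes from a representable, so the full subcategory of elements at representables
inherits this property. Conversely, a functor `A` with a cofiltered category of elements is the
restriction to representables of the functor that takes a presheaf to its filtered colimit over
`A.Elementsᵒᵖ`, which is left exact and has a right adjoint.
-/

open Limits

theorem isEquivalence_lift_of_le_essImage {C D : Type*} [Category* C] [Category* D]
    {F : C ⥤ D} {P : ObjectProperty D} (hF : F.FullyFaithful) (hFP : ∀ X, P (F.obj X))
    (hPF : P ≤ F.essImage) : (P.lift F hFP).IsEquivalence :=
  have := hF.full
  have := hF.faithful
  have : (P.lift F hFP).EssSurj := ⟨fun Y => by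
    obtain ⟨X, ⟨i⟩⟩ := hPF Y.obj Y.property
    exact ⟨X, ⟨P.isoMk i⟩⟩⟩
  { }

section GeometricLogic

variable {L : FirstOrder.Language.{0, 0}}

theorem realize_geometricFormula_comp_hom {M N : Type} [L.Structure M] [L.Structure N]
    (f : M →[L] N) {n : ℕ} {φ : L.GeometricFormula n} {v : Fin n → M} (h : φ.Realize v) :
    φ.Realize (f ∘ v) := by
  induction φ with
  | equal s t =>
    simpa only [Language.GeometricFormula.Realize, Language.HomClass.realize_term]
      using congrArg f h
  | rel R ts =>
    simp only [Language.GeometricFormula.Realize, Language.HomClass.realize_term]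
    exact f.map_rel R _ h
  | top => trivial
  | and φ ψ ihφ ihψ => exact ⟨ihφ h.1, ihψ h.2⟩
  | or φ ih => exact h.imp fun i hi => ih i hi
  | ex φ ih =>
    obtain ⟨x, hx⟩ := h
    exact ⟨f x, Fin.comp_snoc f v x ▸ ih hx⟩

instance isStableUnderRetracts_models (T : L.GeometricTheory) :
    T.Models.IsStableUnderRetracts where
  of_retract {N M} retract hM a v hv := by
    let s : N →[L] M := retract.i
    let r : M →[L] N := retract.r
    have hrs : r ∘ s = id := congrArg (fun f : N →[L] N => (f : N → N)) retract.retract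
    have key : (T.axioms_ a).concl.Realize (r ∘ s ∘ v) :=
      realize_geometricFormula_comp_hom r (hM a _ (realize_geometricFormula_comp_hom s hv))
    rwa [← Function.comp_assoc, hrs, Function.id_comp] at key

end GeometricLogic

section Presheaf

universe w v u v' u'

variable {C : Type u} [Category.{v} C]

instance isLeftKanExtension_yoneda_of_preservesColimits {E : Type u'} [Category.{v'} E]
    (F : (Cᵒᵖ ⥤ Type v) ⥤ E) [PreservesColimitsOfSize.{v, max u v} F] :
    F.IsLeftKanExtension (𝟙 (yoneda ⋙ F)) :=
  Functor.LeftExtension.IsPointwiseLeftKanExtension.isLeftKanExtension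
    (E := Functor.LeftExtension.mk F (𝟙 (yoneda ⋙ F))) fun P =>
      (isColimitOfPreserves F (Presheaf.isColimitTautologicalCocone P)).ofIsoColimit
        (Cocone.ext (Iso.refl _) fun _ => (Category.comp_id _).trans (Category.id_comp _).symm)

/-- Natural transformations out of a colimit-preserving functor on presheaves correspond to natural
transformations out of its restriction to representables. -/
noncomputable def whiskerLeftYonedaEquiv {E : Type u'} [Category.{v'} E]
    (F G : (Cᵒᵖ ⥤ Type v) ⥤ E) [PreservesColimitsOfSize.{v, max u v} F] :
    (F ⟶ G) ≃ (yoneda ⋙ F ⟶ yoneda ⋙ G) :=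
  F.homEquivOfIsLeftKanExtension (𝟙 (yoneda ⋙ F)) G

theorem whiskerLeftYonedaEquiv_apply {E : Type u'} [Category.{v'} E]
    {F G : (Cᵒᵖ ⥤ Type v) ⥤ E} [PreservesColimitsOfSize.{v, max u v} F] (f : F ⟶ G) :
    whiskerLeftYonedaEquiv F G f = Functor.whiskerLeft yoneda f :=
  Category.id_comp (Functor.whiskerLeft yoneda f)

theorem exists_map_yoneda_eq_of_preservesColimits (F : (Cᵒᵖ ⥤ Type v) ⥤ Type w)
    [PreservesColimitsOfSize.{v, max u v} F] {P : Cᵒᵖ ⥤ Type v} (a : F.obj P) :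
    ∃ (X : C) (u : yoneda.obj X ⟶ P) (b : F.obj (yoneda.obj X)), F.map u b = a := by
  obtain ⟨j, b, hb⟩ := Types.jointly_surjective_of_isColimit
    (isColimitOfPreserves F (Presheaf.isColimitTautologicalCocone P)) a
  exact ⟨j.left, j.hom, b, hb⟩

theorem isCofiltered_elements_yoneda_comp (F : (Cᵒᵖ ⥤ Type v) ⥤ Type w)
    [PreservesColimitsOfSize.{v, max u v} F] [PreservesFiniteLimits F] :
    IsCofiltered (yoneda ⋙ F).Elements := by
  have : IsCofiltered (StructuredArrow PUnit F) :=
    (flat_of_preservesFiniteLimits F).cofiltered PUnit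
  have : IsCofiltered (StructuredArrow PUnit (yoneda ⋙ F)) := by
    refine .of_exists_of_isCofiltered_of_fullyFaithful (StructuredArrow.pre PUnit yoneda F)
      fun a => ?_
    obtain ⟨X, u, b, hb⟩ := exists_map_yoneda_eq_of_preservesColimits F (a.hom PUnit.unit)
    exact ⟨.mk (↾fun _ => b), ⟨StructuredArrow.homMk u (by ext; exact hb)⟩⟩
  exact .of_equivalence (CategoryOfElements.structuredArrowEquivalence _).symm

/-- A functor with a cofiltered category of elements, as a point of the site with the trivial
topology. -/
def trivialSitePoint (A : C ⥤ Type w) [IsCofiltered A.Elements] [InitiallySmall.{w} A.Elements] :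
    GrothendieckTopology.Point.{w} (⊥ : GrothendieckTopology C) where
  fiber := A
  jointly_surjective {X} R hR x := by
    obtain rfl := GrothendieckTopology.bot_covering.1 hR
    exact ⟨X, 𝟙 X, trivial, x, by simp⟩

/-- The point of a presheaf topos given by a functor `A` with a cofiltered category of elements: its
inverse image sends `P` to the colimit of `P` over `A.Elementsᵒᵖ`. -/
noncomputable def GeometricMorphism.ofElements [LocallySmall.{w} C] (A : C ⥤ Type w)
    [IsCofiltered A.Elements] [InitiallySmall.{w} A.Elements] :
    GeometricMorphism (Type w) (Cᵒᵖ ⥤ Type w) where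
  inverseImage := (trivialSitePoint A).presheafFiber
  directImage := (trivialSitePoint A).skyscraperPresheafFunctor
  adj := (trivialSitePoint A).skyscraperPresheafAdjunction
  leftExact := inferInstance

/-- The inverse image of the point given by `A` restricts to `A` on representables. -/
noncomputable def GeometricMorphism.yonedaCompOfElementsIso (A : C ⥤ Type v)
    [IsCofiltered A.Elements] [InitiallySmall.{v} A.Elements] :
    yoneda ⋙ (ofElements A).inverseImage ≅ A :=
  Functor.isoWhiskerRight shrinkYonedaIsoYoneda.symm _ ≪≫
    (trivialSitePoint A).shrinkYonedaCompPresheafFiberIso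

end Presheaf

section Points

instance preservesColimits_inverseImage (p : NTimesPt) :
    PreservesColimitsOfSize.{0, 0} p.inverseImage :=
  p.adj.leftAdjoint_preservesColimits

/-- Morphisms of points are the equivariant maps between their actions. -/
noncomputable def pointActionFullyFaithful : pointAction.FullyFaithful where
  preimage f := (whiskerLeftYonedaEquiv _ _).symm f
  map_preimage f :=
    (whiskerLeftYonedaEquiv_apply _).symm.trans ((whiskerLeftYonedaEquiv _ _).apply_symm_apply f)
  preimage_map f :=
    (whiskerLeftYonedaEquiv _ _).symm_apply_eq.2 (whiskerLeftYonedaEquiv_apply f).symm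

theorem isFlatAction_iff_isCofiltered_elements {A : NTimes ⥤ Type} :
    IsFlatAction A ↔ IsCofiltered A.Elements := by
  constructor
  · intro h
    exact
      { cone_objs := by
          rintro ⟨⟨⟩, y⟩ ⟨⟨⟩, z⟩
          obtain ⟨m, n, w, hm, hn⟩ := h.directed y z
          exact ⟨⟨SingleObj.star ℕ+, w⟩, ⟨m, hm⟩, ⟨n, hn⟩, trivial⟩
        cone_maps := by
          rintro ⟨⟨⟩, y⟩ ⟨⟨⟩, z⟩ ⟨m, hm⟩ ⟨n, hn⟩
          obtain ⟨p, w, hp, hw⟩ := h.equalizing m n y (hm.trans hn.symm)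
          exact ⟨⟨SingleObj.star ℕ+, w⟩, ⟨p, hw⟩, Subtype.ext hp⟩
        nonempty := ⟨⟨SingleObj.star ℕ+, h.nonempty.some⟩⟩ }
  · intro h
    refine ⟨?_, fun y z => ?_, fun m n y hy => ?_⟩
    · obtain ⟨⟨⟨⟩, x⟩⟩ := h.nonempty
      exact ⟨x⟩
    · obtain ⟨⟨⟨⟩, w⟩, f, g, -⟩ := h.cone_objs (A.elementsMk _ y) (A.elementsMk _ z)
      exact ⟨f.1, g.1, w, f.2, g.2⟩
    · let f : A.elementsMk _ y ⟶ A.elementsMk _ (A.act n y) := ⟨m, hy⟩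
      let g : A.elementsMk _ y ⟶ A.elementsMk _ (A.act n y) := ⟨n, rfl⟩
      obtain ⟨⟨⟨⟩, w⟩, k, hk⟩ := h.cone_maps f g
      exact ⟨k.1, w, congrArg Subtype.val hk, k.2⟩

theorem isFlatAction_pointAction (p : NTimesPt) : IsFlatAction (pointAction.obj p) :=
  have := p.leftExact
  isFlatAction_iff_isCofiltered_elements.2 (isCofiltered_elements_yoneda_comp p.inverseImage)

theorem exists_pointAction_iso {A : NTimes ⥤ Type} (hA : IsFlatAction A) :
    ∃ p : NTimesPt, Nonempty (pointAction.obj p ≅ A) :=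
  have := isFlatAction_iff_isCofiltered_elements.1 hA
  have : InitiallySmall.{0} A.Elements := initiallySmall_of_essentiallySmall _
  ⟨.ofElements A, ⟨GeometricMorphism.yonedaCompOfElementsIso A⟩⟩

end Points

section Models

/-- Homomorphisms between the structures of actions are the equivariant maps. -/
def actionStructureFullyFaithful : actionStructure.FullyFaithful where
  preimage {A B} f :=
    let f : A.obj (SingleObj.star ℕ+) →[LPt] B.obj (SingleObj.star ℕ+) := f
    SingleObj.natTrans (↾f) fun n => by
      ext x
      exact f.map_fun (PtFunctions.F n) fun _ => x
  map_preimage _ := rfl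
  preimage_map _ := rfl

theorem models_actionStructure_iff {A : NTimes ⥤ Type} :
    flatTheory.Models (actionStructure.obj A) ↔ IsFlatAction A := by
  constructor
  · intro h
    refine ⟨?_, fun y z => ?_, fun m n y hy => ?_⟩
    · obtain ⟨x, -⟩ := h .nonempty Fin.elim0 trivial
      exact ⟨x⟩
    · obtain ⟨⟨m, n⟩, w, hm, hn⟩ := h .directed ![y, z] trivial
      exact ⟨m, n, w, hm, hn⟩
    · obtain ⟨⟨p, hp⟩, z, hz⟩ := h (.equalizing m n) ![y] hy
      exact ⟨p, z, hp, hz⟩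
  · rintro h (_ | ⟨m, n⟩ | _ | _ | ⟨m, n⟩) v hv
    · exact ConcreteCategory.congr_hom (A.map_id (SingleObj.star ℕ+)) (v (0 : Fin 1))
    · exact (ConcreteCategory.congr_hom (A.map_comp (X := SingleObj.star ℕ+)
        (Y := SingleObj.star ℕ+) (Z := SingleObj.star ℕ+) n m) (v (0 : Fin 1))).symm
    · exact ⟨h.nonempty.some, trivial⟩
    · obtain ⟨m, n, w, hm, hn⟩ := h.directed (v (0 : Fin 2)) (v (1 : Fin 2))
      exact ⟨(m, n), w, hm, hn⟩
    · obtain ⟨p, z, hp, hz⟩ := h.equalizing m n (v (0 : Fin 1)) hv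
      exact ⟨⟨p, hp⟩, z, hz⟩

theorem exists_actionStructure_obj_eq {M : Bundled.{0} LPt.Structure}
    (h_one : (flatTheory.axioms_ .one).Holds M)
    (h_mul : ∀ m n, (flatTheory.axioms_ (.mul m n)).Holds M) :
    ∃ A : NTimes ⥤ Type, actionStructure.obj A = M := by
  let A : NTimes ⥤ Type :=
    { obj _ := M
      map n := ↾fun x => Language.Structure.funMap (L := LPt) (PtFunctions.F n) fun _ => x
      map_id _ := by
        ext x
        exact h_one (fun _ => x) trivial
      map_comp n m := by
        ext x
        exact (h_mul m n (fun _ => x) trivial).symm }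
  have h_str : A.ptStructure = M.str := by
    ext k f x
    · obtain ⟨n⟩ := f
      exact congrArg (Language.Structure.funMap (L := LPt) (M := M) (PtFunctions.F n))
        (funext fun i => congrArg x (Subsingleton.elim 0 i))
    · exact f.elim
  exact ⟨A, congrArg (fun S : LPt.Structure M => Bundled.mk M.α S) h_str⟩

theorem models_iff_exists_isFlatAction {M : Bundled.{0} LPt.Structure} :
    flatTheory.Models M ↔
      ∃ A : NTimes ⥤ Type, IsFlatAction A ∧ Nonempty (actionStructure.obj A ≅ M) := by
  constructor
  · intro h
    obtain ⟨A, rfl⟩ := exists_actionStructure_obj_eq (h .one) fun m n => h (.mul m n)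
    exact ⟨A, models_actionStructure_iff.1 h, ⟨Iso.refl _⟩⟩
  · rintro ⟨A, hA, ⟨i⟩⟩
    exact flatTheory.Models.prop_of_iso i (models_actionStructure_iff.2 hA)

theorem models_pointStructure (p : NTimesPt) : flatTheory.Models (pointStructure.obj p) :=
  models_actionStructure_iff.2 (isFlatAction_pointAction p)

theorem models_iff_essImage_pointStructure {M : Bundled.{0} LPt.Structure} :
    flatTheory.Models M ↔ pointStructure.essImage M := by
  constructor
  · intro h
    obtain ⟨A, hA, ⟨i⟩⟩ := models_iff_exists_isFlatAction.1 h
    obtain ⟨p, ⟨j⟩⟩ := exists_pointAction_iso hA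
    exact ⟨p, ⟨actionStructure.mapIso j ≪≫ i⟩⟩
  · rintro ⟨p, ⟨i⟩⟩
    exact flatTheory.Models.prop_of_iso i (models_pointStructure p)

end Models

theorem mainTheorem10 :
    -- the models of the theory are exactly the flat actions
    (∀ M : Bundled.{0} LPt.Structure, flatTheory.Models M ↔
      ∃ A : NTimes ⥤ Type, IsFlatAction A ∧ Nonempty (actionStructure.obj A ≅ M)) ∧
    -- the models of the theory are exactly the structures of points
    (∀ M : Bundled.{0} LPt.Structure, flatTheory.Models M ↔
      ∃ p : NTimesPt, Nonempty (pointStructure.obj p ≅ M)) ∧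
    -- the category of points is equivalent to the category of models
    ∃ h : ∀ p : NTimesPt, flatTheory.Models (pointStructure.obj p),
      (flatTheory.Models.lift pointStructure h).IsEquivalence := by
  refine ⟨fun _ => models_iff_exists_isFlatAction, fun _ => models_iff_essImage_pointStructure,
    models_pointStructure, ?_⟩
  exact isEquivalence_lift_of_le_essImage
    (pointActionFullyFaithful.comp actionStructureFullyFaithful)
    models_pointStructure fun _ => models_iff_essImage_pointStructure.1
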